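/- Proposition 4.2. A *graph* is a set $V(G)$ of vertices with a symmetric relation $E(G)\subset V(G)\times V(G)$ (loops are allowed); $K_2$ is the graph with vertices $0,1$ and $E(K_2)=\{(0,1),(1,0)\}$; the product $G\times H$ has $V(G\times H)=V(G)\times V(H)$ and $((x,y),(x',y'))\in E(G\times H)$ iff $(x,x')\in E(G)$ and $(y,y')\in E(H)$. $C(G)$ denotes the poset of nonempty finite sets $\sigma\subset V(G)$ with $\sigma\times\sigma\subset E(G)$, ordered by inclusion; a graph homomorphism $f:G\to H$ induces the order-preserving map $f_*:C(G)\to C(H)$, $\sigma\mapsto f(\sigma)$. A *bigraph* is a graph $X$ with a graph homomorphism $\varepsilon_X:X\to K_2$; $K_2$ is a bigraph through the identity. A bigraph homomorphism is a graph homomorphism that commutes with the $2$-colorings $\varepsilon$. For bigraphs $X,Y$, the graph $X^Y$ has as vertices all maps $f:V(Y)\to V(X)$ with $\varepsilon_X\circ f=\varepsilon_Y$, and $(f,g)\in E(X^Y)$ iff $(f\times g)(E(Y))\subset E(X)$; a bigraph homomorphism $h:Y\to Z$ induces the graph homomorphism $h^*:X^Z\to X^Y$, $f\mapsto f\circ h$.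 For integers $a\le b$ let $L_{a,b}$ be the bigraph with vertices the integers $x$ with $a\le x\le b$, with $x,y$ adjacent iff $|x-y|=1$, and with coloring $x\mapsto x \bmod 2$. For $n\ge 0$ let $r_n:L_{-n-1,n+2}\to L_{-n,n+1}$ be the retraction, which sends $-n-1\mapsto -n+1$ and $n+2\mapsto n$ and fixes all other vertices. For a bigraph $X$, let $X^L$ be the colimit, in the category of graphs, of $$X^{L_{0,1}}\xrightarrow{r_0^*}X^{L_{-1,2}}\xrightarrow{r_1^*}\cdots\to X^{L_{-n,n+1}}\xrightarrow{r_n^*}\cdots .$$ For $k=\pm 2n$ let $\iota_k:K_2\to L_{-2n,2n+1}$, $\iota_k(i)=k+i$. The homomorphisms $\iota_{-2n}^*,\iota_{2n}^*:X^{L_{-2n,2n+1}}\to X^{K_2}$ are compatible with the maps of the sequence and induce graph homomorphisms $e_{-\infty},e_{+\infty}:X^L\to X^{K_2}$. Then for every bigraph $X$ the order-preserving map $$p=(e_{-\infty},e_{+\infty})_*: C(X^L)\longrightarrow C(X^{K_2}\times X^{K_2})$$ satisfies the hypothesis of Quillen's Theorem B: for all $\sigma,\sigma'\in C(X^{K_2}\times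 X^{K_2})$ with $\sigma\le\sigma'$, the inclusion $$p^{-1}\bigl(C(X^{K_2}\times X^{K_2})_{\le\sigma}\bigr)\hookrightarrow p^{-1}\bigl(C(X^{K_2}\times X^{K_2})_{\le\sigma'}\bigr)$$ is a homotopy equivalence, that is, it induces a homotopy equivalence of classifying spaces (the geometric realizations of the order complexes). -/

import Mathlib

universe u v w

/-! ### Classifying spaces of posets -/

/-- The (underlying set of the) geometric realization of an abstract simplicial complex `K`:
finitely supported families of barycentric coordinates whose support is a face of `K`. -/
def Realization {ι : Type u} (K : AbstractSimplicialComplex ι) : Type u :=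
  {x : ι →₀ ℝ // (∀ i, 0 ≤ x i) ∧ (x.sum fun _ a => a) = 1 ∧ x.support ∈ K}

namespace Realization

variable {ι : Type u} {κ : Type v} {K : AbstractSimplicialComplex ι}
  {L : AbstractSimplicialComplex κ}

theorem support_mapDomain_of_nonneg {α β : Type*} [DecidableEq β] (f : α → β) (x : α →₀ ℝ)
    (hx : ∀ i, 0 ≤ x i) : (x.mapDomain f).support = x.support.image f := by
  refine Finset.Subset.antisymm Finsupp.mapDomain_support ?_
  intro b hb
  obtain ⟨a, ha, rfl⟩ := Finset.mem_image.1 hb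
  rw [Finsupp.mem_support_iff, Finsupp.mapDomain, Finsupp.sum_apply, Finsupp.sum]
  refine ne_of_gt (Finset.sum_pos' (fun i _ => ?_) ⟨a, ha, ?_⟩)
  · rw [Finsupp.single_apply]
    split_ifs
    exacts [hx i, le_rfl]
  · rw [Finsupp.single_eq_same]
    exact lt_of_le_of_ne (hx a) (Ne.symm (Finsupp.mem_support_iff.1 ha))

theorem mapDomain_nonneg {α β : Type*} (f : α → β) (x : α →₀ ℝ)
    (hx : ∀ i, 0 ≤ x i) (b : β) : 0 ≤ x.mapDomain f b := by
  classical
  rw [Finsupp.mapDomain, Finsupp.sum_apply, Finsupp.sum]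
  refine Finset.sum_nonneg fun i _ => ?_
  rw [Finsupp.single_apply]
  split_ifs
  exacts [hx i, le_rfl]

theorem sum_mapDomain {α β : Type*} (f : α → β) (x : α →₀ ℝ) :
    ((x.mapDomain f).sum fun _ a => a) = x.sum fun _ a => a :=
  Finsupp.sum_mapDomain_index (fun _ => rfl) (fun _ _ _ => rfl)

/-- The characteristic map of the closed simplex spanned by a face `s` of `K`. -/
noncomputable def simplexMap (K : AbstractSimplicialComplex ι) (s : Finset ι) (hs : s ∈ K)
    (t : stdSimplex ℝ s) : Realization K :=
  ⟨(Finsupp.equivFunOnFinite.symm (t : s → ℝ)).mapDomain Subtype.val, by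
    classical
    have h0 : ∀ i, 0 ≤ Finsupp.equivFunOnFinite.symm (t : s → ℝ) i := fun i => t.2.1 i
    have h1 : (((Finsupp.equivFunOnFinite.symm (t : s → ℝ)).mapDomain
        (Subtype.val : s → ι)).sum fun _ a => a) = 1 := by
      rw [sum_mapDomain, Finsupp.sum_fintype _ _ (fun _ => rfl)]
      exact t.2.2
    refine ⟨mapDomain_nonneg _ _ h0, h1, ?_⟩
    refine (K.isRelLowerSet_faces hs).2 ?_ ?_
    · refine Finsupp.mapDomain_support.trans ?_
      intro i hi
      obtain ⟨a, -, rfl⟩ := Finset.mem_image.1 hi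
      exact a.2
    · by_contra h
      rw [Finset.not_nonempty_iff_eq_empty] at h
      rw [Finsupp.sum, h, Finset.sum_empty] at h1
      exact zero_ne_one h1⟩

/-- The weak topology: a set is open iff its preimage in every closed simplex is open. -/
noncomputable instance : TopologicalSpace (Realization K) :=
  ⨆ s : {s : Finset ι // s ∈ K}, TopologicalSpace.coinduced (simplexMap K s.1 s.2) inferInstance

theorem continuous_simplexMap (s : Finset ι) (hs : s ∈ K) : Continuous (simplexMap K s hs) := by
  rw [continuous_iff_coinduced_le]
  exact le_iSup (fun s : {s : Finset ι // s ∈ K} =>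
    TopologicalSpace.coinduced (simplexMap K s.1 s.2) inferInstance) ⟨s, hs⟩

theorem continuous_of_simplexMap {Y : Type*} [TopologicalSpace Y] {f : Realization K → Y}
    (hf : ∀ (s : Finset ι) (hs : s ∈ K), Continuous (f ∘ simplexMap K s hs)) : Continuous f :=
  continuous_iSup_dom.2 fun s => continuous_coinduced_dom.2 (hf s.1 s.2)

/-- The map of geometric realizations induced by a simplicial map: it extends the map on
vertices linearly over each simplex. -/
noncomputable def map (f : ι → κ) (hf : ∀ s ∈ K, ∀ t : Finset κ, (t : Set κ) = f '' s → t ∈ L) :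
    C(Realization K, Realization L) where
  toFun x := ⟨x.1.mapDomain f, mapDomain_nonneg f _ x.2.1, (sum_mapDomain f _).trans x.2.2.1, by
    classical
    rw [support_mapDomain_of_nonneg f _ x.2.1]
    exact hf _ x.2.2.2 _ (by simp)⟩
  continuous_toFun := by
    classical
    refine continuous_of_simplexMap fun s hs => ?_
    have ht : s.image f ∈ L := hf s hs _ (by simp)
    let g : s → (s.image f : Finset κ) := fun a => ⟨f a, Finset.mem_image_of_mem f a.2⟩
    convert (continuous_simplexMap (K := L) (s.image f) ht).comp
      (stdSimplex.continuous_map (S := ℝ) g) using 1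
    funext t
    refine Subtype.ext ?_
    have h1 : Finsupp.equivFunOnFinite.symm (stdSimplex.map g t : {b // b ∈ s.image f} → ℝ)
        = (Finsupp.equivFunOnFinite.symm (t : s → ℝ)).mapDomain g := by
      ext b
      simp only [stdSimplex.map_coe, FunOnFinite.linearMap]
      rfl
    change ((Finsupp.equivFunOnFinite.symm (t : s → ℝ)).mapDomain Subtype.val).mapDomain f =
      (Finsupp.equivFunOnFinite.symm
        (stdSimplex.map g t : {b // b ∈ s.image f} → ℝ)).mapDomain Subtype.val
    rw [h1, ← Finsupp.mapDomain_comp, ← Finsupp.mapDomain_comp]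
    rfl

end Realization

/-- The order complex of a poset: its faces are the nonempty finite chains. -/
def orderComplex (P : Type u) [PartialOrder P] : AbstractSimplicialComplex P where
  faces := {s | s.Nonempty ∧ IsChain (· ≤ ·) (s : Set P)}
  isRelLowerSet_faces := fun _ hs =>
    ⟨hs.1, fun _ hts ht => ⟨ht, hs.2.mono (Finset.coe_subset.2 hts)⟩⟩
  singleton_mem := fun v => ⟨Finset.singleton_nonempty v, by simp⟩

/-- The classifying space `|P|` of a poset `P`. -/
abbrev ClassifyingSpace (P : Type u) [PartialOrder P] : Type u := Realization (orderComplex P)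

/-- The continuous map `|P| → |Q|` induced by an order-preserving map `P → Q`. -/
noncomputable def classifyingMap {P : Type u} {Q : Type v} [PartialOrder P] [PartialOrder Q]
    (f : P →o Q) : C(ClassifyingSpace P, ClassifyingSpace Q) :=
  Realization.map f fun s hs t ht => by
    refine ⟨?_, ?_⟩
    · rw [← Finset.coe_nonempty, ht]
      exact (Finset.coe_nonempty.2 hs.1).image f
    · rw [ht]
      rintro _ ⟨a, ha, rfl⟩ _ ⟨b, hb, rfl⟩ _
      exact (hs.2.total ha hb).imp (fun h => f.monotone h) (fun h => f.monotone h)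

/-- An order-preserving map is a homotopy equivalence if the induced continuous map of
classifying spaces is one. -/
def IsPosetHomotopyEquiv {P : Type u} {Q : Type v} [PartialOrder P] [PartialOrder Q]
    (f : P →o Q) : Prop :=
  ∃ e : ContinuousMap.HomotopyEquiv (ClassifyingSpace P) (ClassifyingSpace Q),
    e.toFun = classifyingMap f

/-- The subposet `p⁻¹(Q_{≤ y})` of `P`. -/
abbrev LowerFiber {P : Type u} {Q : Type v} [PartialOrder P] [PartialOrder Q]
    (p : P →o Q) (y : Q) : Type u :=
  {x : P // p x ≤ y}

/-- The inclusion `p⁻¹(Q_{≤ y}) ↪ p⁻¹(Q_{≤ y'})` for `y ≤ y'`. -/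
def lowerFiberInclusion {P : Type u} {Q : Type v} [PartialOrder P] [PartialOrder Q]
    (p : P →o Q) {y y' : Q} (h : y ≤ y') : LowerFiber p y →o LowerFiber p y' where
  toFun x := ⟨x.1, x.2.trans h⟩
  monotone' _ _ hab := hab

/-- The hypothesis of Quillen's Theorem B for an order-preserving map of posets. -/
def QuillenBHypothesis {P : Type u} {Q : Type v} [PartialOrder P] [PartialOrder Q]
    (p : P →o Q) : Prop :=
  ∀ (y y' : Q) (h : y ≤ y'), IsPosetHomotopyEquiv (lowerFiberInclusion p h)

/-! ### Graphs, possibly with loops -/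

/-- A graph: a set of vertices with a symmetric relation. Loops are allowed. -/
structure LoopGraph where
  V : Type u
  Adj : V → V → Prop
  symm : ∀ x y, Adj x y → Adj y x

/-- Graph homomorphisms. -/
@[ext]
structure LoopGraph.Hom (G : LoopGraph.{u}) (H : LoopGraph.{v}) where
  toFun : G.V → H.V
  map_adj : ∀ x y, G.Adj x y → H.Adj (toFun x) (toFun y)

namespace LoopGraph

/-- The complete graph `K_n` (without loops). -/
def complete (n : ℕ) : LoopGraph.{0} where
  V := Fin n
  Adj x y := x ≠ y
  symm _ _ h := h.symm

/-- The categorical product of graphs. -/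
def prod (G : LoopGraph.{u}) (H : LoopGraph.{v}) : LoopGraph.{max u v} where
  V := G.V × H.V
  Adj p q := G.Adj p.1 q.1 ∧ H.Adj p.2 q.2
  symm _ _ h := ⟨G.symm _ _ h.1, H.symm _ _ h.2⟩

/-- The homomorphism into a product with given components. -/
def Hom.pair {T : LoopGraph.{u}} {G : LoopGraph.{v}} {H : LoopGraph.{w}}
    (f : Hom T G) (g : Hom T H) : Hom T (prod G H) where
  toFun x := (f.toFun x, g.toFun x)
  map_adj x y h := ⟨f.map_adj x y h, g.map_adj x y h⟩

/-- The poset `C(G)`: nonempty finite sets `σ` of vertices with `σ × σ ⊆ E(G)`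
(so that all members are looped), ordered by inclusion. -/
abbrev CliquePoset (G : LoopGraph.{u}) : Type u :=
  {σ : Finset G.V // σ.Nonempty ∧ ∀ x ∈ σ, ∀ y ∈ σ, G.Adj x y}

open Classical in
/-- The order-preserving map `f_* : C(G) → C(H)`, `σ ↦ f(σ)`. -/
noncomputable def cliqueMap {G : LoopGraph.{u}} {H : LoopGraph.{v}} (f : Hom G H) :
    CliquePoset G →o CliquePoset H where
  toFun σ := ⟨σ.1.image f.toFun, σ.2.1.image _, by
    intro x hx y hy
    obtain ⟨a, ha, rfl⟩ := Finset.mem_image.1 hx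
    obtain ⟨b, hb, rfl⟩ := Finset.mem_image.1 hy
    exact f.map_adj a b (σ.2.2 a ha b hb)⟩
  monotone' _ _ h := Finset.image_subset_image h

/-- The colimit of a sequence of graphs `G 0 → G 1 → ⋯`: the vertex set is the colimit of the
vertex sets, and two vertices are adjacent iff they have adjacent representatives at some
stage. -/
def seqColim (G : ℕ → LoopGraph.{u}) (r : ∀ n, Hom (G n) (G (n + 1))) : LoopGraph.{u} where
  V := Quot fun p q : (Σ n, (G n).V) => q = ⟨p.1 + 1, (r p.1).toFun p.2⟩
  Adj a b := ∃ (n : ℕ) (x y : (G n).V),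
    a = Quot.mk _ ⟨n, x⟩ ∧ b = Quot.mk _ ⟨n, y⟩ ∧ (G n).Adj x y
  symm _ _ := fun ⟨n, x, y, hx, hy, h⟩ => ⟨n, y, x, hy, hx, (G n).symm x y h⟩

/-- The homomorphism out of a sequential colimit given by a compatible family. -/
def seqColimLift {G : ℕ → LoopGraph.{u}} {r : ∀ n, Hom (G n) (G (n + 1))} {H : LoopGraph.{v}}
    (e : ∀ n, Hom (G n) H) (he : ∀ n x, (e (n + 1)).toFun ((r n).toFun x) = (e n).toFun x) :
    Hom (seqColim G r) H where
  toFun := Quot.lift (fun p => (e p.1).toFun p.2) (by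
    rintro ⟨n, x⟩ _ rfl
    exact (he n x).symm)
  map_adj := by
    rintro _ _ ⟨n, x, y, rfl, rfl, h⟩
    exact (e n).map_adj x y h

end LoopGraph

/-! ### Bigraphs -/

/-- A bigraph: a graph with a 2-coloring, i.e. a graph homomorphism to `K_2`. -/
structure Bigraph where
  graph : LoopGraph.{u}
  color : LoopGraph.Hom graph (LoopGraph.complete 2)

/-- Bigraph homomorphisms: graph homomorphisms commuting with the 2-colorings. -/
structure Bigraph.Hom (X : Bigraph.{u}) (Y : Bigraph.{v}) extends
    LoopGraph.Hom X.graph Y.graph where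
  color_eq : ∀ x, Y.color.toFun (toFun x) = X.color.toFun x

namespace Bigraph

/-- `K_2` as a bigraph, colored by the identity. -/
def K2 : Bigraph.{0} where
  graph := LoopGraph.complete 2
  color := ⟨id, fun _ _ h => h⟩

/-- The graph `X ^ Y`: its vertices are the maps `V(Y) → V(X)` commuting with the 2-colorings
(not necessarily homomorphisms), and `f`, `g` are adjacent iff `(f × g)(E(Y)) ⊆ E(X)`. -/
def exp (X : Bigraph.{u}) (Y : Bigraph.{v}) : LoopGraph.{max u v} where
  V := {f : Y.graph.V → X.graph.V // ∀ y, X.color.toFun (f y) = Y.color.toFun y}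
  Adj f g := ∀ y y', Y.graph.Adj y y' → X.graph.Adj (f.1 y) (g.1 y')
  symm _ _ h y y' hy := X.graph.symm _ _ (h y' y (Y.graph.symm _ _ hy))

/-- Precomposition `h^* : X ^ Z → X ^ Y`, `f ↦ f ∘ h`, with a bigraph homomorphism
`h : Y → Z`. -/
def expPrecomp (X : Bigraph.{u}) {Y : Bigraph.{v}} {Z : Bigraph.{w}} (h : Hom Y Z) :
    LoopGraph.Hom (X.exp Z) (X.exp Y) where
  toFun f := ⟨fun y => f.1 (h.toFun y), fun y => (f.2 _).trans (h.color_eq y)⟩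
  map_adj _ _ hfg y y' hy := hfg _ _ (h.map_adj y y' hy)

/-- The path bigraph `L_{a,b}` on the integers `a, …, b`, where `x` and `y` are adjacent iff
`|x - y| = 1` and the color of `x` is `x mod 2`. -/
def line (a b : ℤ) : Bigraph.{0} where
  graph :=
    { V := {x : ℤ // a ≤ x ∧ x ≤ b}
      Adj := fun x y => |x.1 - y.1| = 1
      symm := fun x y h => by rwa [abs_sub_comm] }
  color :=
    { toFun := fun x => if Even x.1 then (0 : Fin 2) else (1 : Fin 2)
      map_adj := by
        rintro ⟨x, hx⟩ ⟨y, hy⟩ h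
        change (if Even x then (0 : Fin 2) else 1) ≠ (if Even y then (0 : Fin 2) else 1)
        have h' : |x - y| = 1 := h
        rw [abs_eq (by norm_num)] at h'
        split_ifs with h1 h2 h2 <;> simp only [Int.even_iff] at * <;>
          first | decide | (exfalso; omega) }

/-- The bigraph `L_{-n,n+1}`. -/
abbrev symLine (n : ℕ) : Bigraph.{0} := line (-(n : ℤ)) ((n : ℤ) + 1)

/-- The retraction `r_n : L_{-n-1,n+2} → L_{-n,n+1}`, which folds each end edge onto its
neighbor. -/
def retraction (n : ℕ) : Hom (symLine (n + 1)) (symLine n) where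
  toFun x := ⟨if x.1 < -(n : ℤ) then x.1 + 2 else if (n : ℤ) + 1 < x.1 then x.1 - 2 else x.1, by
    have h1 := x.2.1
    have h2 := x.2.2
    push_cast at h1 h2
    constructor <;> split_ifs <;> omega⟩
  map_adj := by
    rintro ⟨x, hx1, hx2⟩ ⟨y, hy1, hy2⟩ h
    have h' : |x - y| = 1 := h
    change |(if x < -(n : ℤ) then x + 2 else if (n : ℤ) + 1 < x then x - 2 else x) -
      (if y < -(n : ℤ) then y + 2 else if (n : ℤ) + 1 < y then y - 2 else y)| = 1
    push_cast at hx1 hx2 hy1 hy2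
    rw [abs_eq (by norm_num)] at h' ⊢
    split_ifs <;> omega
  color_eq := by
    rintro ⟨x, hx1, hx2⟩
    change (if Even (if x < -(n : ℤ) then x + 2 else if (n : ℤ) + 1 < x then x - 2 else x)
      then (0 : Fin 2) else 1) = if Even x then (0 : Fin 2) else 1
    congr 1
    rw [eq_iff_iff, Int.even_iff, Int.even_iff]
    split_ifs <;> omega

/-- The bigraph homomorphism `ι_k : K_2 → L_{-n,n+1}` onto the edge `{k, k+1}`. It is unique:
it sends `i` to `k + i` if `k` is even, and to `k + (1 - i)` if `k` is odd. -/
def edgeInclusion (n : ℕ) (k : ℤ) (h1 : -(n : ℤ) ≤ k) (h2 : k ≤ n) : Hom K2 (symLine n) where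
  toFun (i : Fin 2) := ⟨if Even k then k + (i.val : ℤ) else k + (1 - (i.val : ℤ)), by
    have := i.isLt
    constructor <;> split_ifs <;> omega⟩
  map_adj (i j : Fin 2) h := by
    have h' : i ≠ j := h
    rw [ne_eq, Fin.ext_iff] at h'
    have := i.isLt
    have := j.isLt
    change |(if Even k then k + (i.val : ℤ) else k + (1 - (i.val : ℤ))) -
      (if Even k then k + (j.val : ℤ) else k + (1 - (j.val : ℤ)))| = 1
    rw [abs_eq (by norm_num)]
    split_ifs <;> omega
  color_eq (i : Fin 2) := by
    change (if Even (if Even k then k + (i.val : ℤ) else k + (1 - (i.val : ℤ)))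
      then (0 : Fin 2) else 1) = i
    have hi := i.isLt
    simp only [Int.even_iff, Fin.ext_iff]
    split_ifs <;> simp <;> omega

/-- The graph `X ^ L` of stable paths: the colimit of
`X ^ L_{0,1} → X ^ L_{-1,2} → ⋯ → X ^ L_{-n,n+1} → ⋯` along the maps `r_n^*`. -/
def stablePath (X : Bigraph.{u}) : LoopGraph.{u} :=
  LoopGraph.seqColim (fun n => X.exp (symLine n)) fun n => X.expPrecomp (retraction n)

/-- `e_{-∞} : X ^ L → X ^ K_2`, induced by the restrictions `ι_{-n}^*` to the first edge. -/
def evalNegInf (X : Bigraph.{u}) : LoopGraph.Hom X.stablePath (X.exp K2) :=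
  LoopGraph.seqColimLift
    (fun n => X.expPrecomp (edgeInclusion n (-(n : ℤ)) le_rfl (by omega)))
    (by
      intro n f
      refine Subtype.ext (funext fun (i : Fin 2) => congrArg f.1 (Subtype.ext ?_))
      have hi := i.isLt
      change (if (if Even (-((n + 1 : ℕ) : ℤ)) then -((n + 1 : ℕ) : ℤ) + (i.val : ℤ)
            else -((n + 1 : ℕ) : ℤ) + (1 - (i.val : ℤ))) < -(n : ℤ) then
          (if Even (-((n + 1 : ℕ) : ℤ)) then -((n + 1 : ℕ) : ℤ) + (i.val : ℤ)
            else -((n + 1 : ℕ) : ℤ) + (1 - (i.val : ℤ))) + 2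
        else if (n : ℤ) + 1 < (if Even (-((n + 1 : ℕ) : ℤ)) then -((n + 1 : ℕ) : ℤ) + (i.val : ℤ)
            else -((n + 1 : ℕ) : ℤ) + (1 - (i.val : ℤ))) then
          (if Even (-((n + 1 : ℕ) : ℤ)) then -((n + 1 : ℕ) : ℤ) + (i.val : ℤ)
            else -((n + 1 : ℕ) : ℤ) + (1 - (i.val : ℤ))) - 2
        else (if Even (-((n + 1 : ℕ) : ℤ)) then -((n + 1 : ℕ) : ℤ) + (i.val : ℤ)
            else -((n + 1 : ℕ) : ℤ) + (1 - (i.val : ℤ)))) =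
        if Even (-(n : ℤ)) then -(n : ℤ) + (i.val : ℤ) else -(n : ℤ) + (1 - (i.val : ℤ))
      simp only [Int.even_iff]
      push_cast
      split_ifs <;> omega)

/-- `e_{+∞} : X ^ L → X ^ K_2`, induced by the restrictions `ι_n^*` to the last edge. -/
def evalPosInf (X : Bigraph.{u}) : LoopGraph.Hom X.stablePath (X.exp K2) :=
  LoopGraph.seqColimLift
    (fun n => X.expPrecomp (edgeInclusion n (n : ℤ) (by omega) le_rfl))
    (by
      intro n f
      refine Subtype.ext (funext fun (i : Fin 2) => congrArg f.1 (Subtype.ext ?_))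
      have hi := i.isLt
      change (if (if Even ((n + 1 : ℕ) : ℤ) then ((n + 1 : ℕ) : ℤ) + (i.val : ℤ)
            else ((n + 1 : ℕ) : ℤ) + (1 - (i.val : ℤ))) < -(n : ℤ) then
          (if Even ((n + 1 : ℕ) : ℤ) then ((n + 1 : ℕ) : ℤ) + (i.val : ℤ)
            else ((n + 1 : ℕ) : ℤ) + (1 - (i.val : ℤ))) + 2
        else if (n : ℤ) + 1 < (if Even ((n + 1 : ℕ) : ℤ) then ((n + 1 : ℕ) : ℤ) + (i.val : ℤ)
            else ((n + 1 : ℕ) : ℤ) + (1 - (i.val : ℤ))) then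
          (if Even ((n + 1 : ℕ) : ℤ) then ((n + 1 : ℕ) : ℤ) + (i.val : ℤ)
            else ((n + 1 : ℕ) : ℤ) + (1 - (i.val : ℤ))) - 2
        else (if Even ((n + 1 : ℕ) : ℤ) then ((n + 1 : ℕ) : ℤ) + (i.val : ℤ)
            else ((n + 1 : ℕ) : ℤ) + (1 - (i.val : ℤ)))) =
        if Even (n : ℤ) then (n : ℤ) + (i.val : ℤ) else (n : ℤ) + (1 - (i.val : ℤ))
      simp only [Int.even_iff]
      push_cast
      split_ifs <;> omega)

/-- `(e_{-∞}, e_{+∞}) : X ^ L → X ^ K_2 × X ^ K_2`. -/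
def endpoints (X : Bigraph.{u}) :
    LoopGraph.Hom X.stablePath ((X.exp K2).prod (X.exp K2)) :=
  LoopGraph.Hom.pair X.evalNegInf X.evalPosInf

end Bigraph

/-! The lower fiber over `ρ'` is the face poset of a complex of cliques of stable paths, and the
lower fiber over a smaller `ρ` is the face poset of the full subcomplex on the paths whose pair of
ends lies in `ρ`. Fix `(a, b)` in `ρ`. A path is moved into the subcomplex by cutting it off outside
`{-m, …, m + 1}` and continuing with `a` and `b` (`extend`). Since `ρ'` is a clique, its pairs of
ends are all adjacent to `(a, b)`; hence late enough cutoffs of a clique span a clique together with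
the original paths (`adj_extend`, `extend_adj_extend`).

The difficulty is that stabilization stages are unbounded: no single `m` serves all paths, and
cutoffs chosen separately for each path need not preserve adjacency. So a cutoff is attached to each
face `j`, and it is good for all faces contained in `j`. A point of the classifying space is a
weighted chain of faces. Splitting the chain at its median gives low and high faces, with weights
depending continuously on the point, such that every low face is contained in every high face
(`le_of_lowWeight_of_highWeight`). Vertices of low faces are then pushed by the cutoffs of high
faces.

The homotopy leads from the given point to the function on vertices that spreads out the low
weights, and on to its pushed version. A function on vertices is turned back into a point of the
order complex through its chain of superlevel sets (`levelWeight`). The outcome is the criterion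
`isPosetHomotopyEquiv_of_push`. -/

open scoped NNReal unitInterval

/-! ### Continuity in the weak topology, and points given by unnormalized weights. -/

namespace Realization

variable {ι : Type u} {κ : Type v} {K : AbstractSimplicialComplex ι}

theorem nonempty_of_mem {s : Finset ι} (hs : s ∈ K) : s.Nonempty :=
  (K.isRelLowerSet_faces hs).1

theorem simplexMap_apply_mem (s : Finset ι) (hs : s ∈ K) (t : stdSimplex ℝ s) (i : s) :
    (simplexMap K s hs t).1 i = t i :=
  Finsupp.mapDomain_apply Subtype.val_injective _ i

theorem simplexMap_apply_notMem (s : Finset ι) (hs : s ∈ K) (t : stdSimplex ℝ s) {i : ι}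
    (hi : i ∉ s) : (simplexMap K s hs t).1 i = 0 :=
  Finsupp.mapDomain_of_notMem_range _ _ (by simpa using hi)

theorem support_simplexMap_subset (s : Finset ι) (hs : s ∈ K) (t : stdSimplex ℝ s) :
    (simplexMap K s hs t).1.support ⊆ s := fun i hi => by
  by_contra h
  exact Finsupp.mem_support_iff.1 hi (simplexMap_apply_notMem s hs t h)

theorem continuous_simplexMap_apply (s : Finset ι) (hs : s ∈ K) (i : ι) :
    Continuous fun t => (simplexMap K s hs t).1 i := by
  by_cases hi : i ∈ s
  · simp_rw [simplexMap_apply_mem s hs _ ⟨i, hi⟩]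
    exact (continuous_apply (⟨i, hi⟩ : s)).comp continuous_subtype_val
  · simp_rw [simplexMap_apply_notMem s hs _ hi]
    exact continuous_const

/-- The barycentric coordinates of a point with respect to a finite set containing its support. -/
def coords (x : Realization K) (s : Finset ι) (hx : x.1.support ⊆ s) : stdSimplex ℝ s :=
  ⟨fun i => x.1 i, fun i => x.2.1 i, by
    rw [Finset.sum_coe_sort s x.1]
    exact (Finsupp.sum_of_support_subset _ hx _ fun _ _ => rfl).symm.trans x.2.2.1⟩

theorem simplexMap_coords (x : Realization K) (s : Finset ι) (hs : s ∈ K)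
    (hx : x.1.support ⊆ s) : simplexMap K s hs (x.coords s hx) = x := by
  refine Subtype.ext (Finsupp.ext fun i => ?_)
  by_cases hi : i ∈ s
  · exact simplexMap_apply_mem s hs _ ⟨i, hi⟩
  · rw [simplexMap_apply_notMem s hs _ hi, eq_comm, ← Finsupp.notMem_support_iff]
    exact fun h => hi (hx h)

/-- A map into a realization whose values are supported in a fixed finite set is continuous as
soon as its barycentric coordinates are. -/
theorem continuous_of_coord {Z : Type*} [TopologicalSpace Z] {g : Z → Realization K}
    (S : Finset ι) (hS : ∀ z, (g z).1.support ⊆ S) (hc : ∀ i, Continuous fun z => (g z).1 i) :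
    Continuous g := by
  classical
  have hcov : ⋃ s : {s : Finset ι // s ⊆ S ∧ s ∈ K}, {z | (g z).1.support ⊆ s.1} = Set.univ :=
    Set.eq_univ_of_forall fun z =>
      Set.mem_iUnion.2 ⟨⟨(g z).1.support, hS z, (g z).2.2.2⟩, Finset.Subset.refl _⟩
  have : Finite {s : Finset ι // s ⊆ S ∧ s ∈ K} :=
    ((S.powerset.finite_toSet).subset fun s hs => by
      simpa using hs.1 : {s : Finset ι | s ⊆ S ∧ s ∈ K}.Finite).to_subtype
  -- Pasting over a finite closed cover: on the set where the support lies in a fixed face, the map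
  -- factors through the closed simplex of that face.
  refine (locallyFinite_of_finite _).continuous hcov (fun s => ?_) fun s => ?_
  · have : {z | (g z).1.support ⊆ s.1} = ⋂ i ∉ s.1, {z | (g z).1 i = 0} := by
      ext z
      simp only [Set.mem_ofPred_eq, Set.mem_iInter]
      refine ⟨fun h i hi => by_contra fun h0 => hi (h (Finsupp.mem_support_iff.2 h0)),
        fun h i hi => by_contra fun h0 => Finsupp.mem_support_iff.1 hi (h i h0)⟩
    rw [this]
    exact isClosed_biInter fun i _ => isClosed_eq (hc i) continuous_const
  · rw [continuousOn_iff_continuous_domRestrict]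
    have h : Continuous fun z : {z | (g z).1.support ⊆ s.1} =>
        simplexMap K s.1 s.2.2 ((g z.1).coords s.1 z.2) :=
      (continuous_simplexMap _ _).comp (continuous_induced_rng.2
        (continuous_pi fun i => (hc i).comp continuous_subtype_val))
    exact h.congr fun z => simplexMap_coords _ _ _ z.2

/-- Continuity of a map out of the cylinder of a realization can be checked on the cylinders of
the closed simplices. -/
theorem continuous_cylinder_of_simplexMap {Y : Type*} [TopologicalSpace Y]
    {f : I × Realization K → Y}
    (hf : ∀ (s : Finset ι) (hs : s ∈ K),
      Continuous fun p : I × stdSimplex ℝ s => f (p.1, simplexMap K s hs p.2)) :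
    Continuous f := by
  have hx : ∀ x : Realization K, Continuous fun t => f (t, x) := fun x => by
    have h := (hf _ x.2.2.2).comp
      (Continuous.prodMk_left (x.coords x.1.support (Finset.Subset.refl _)))
    simpa [Function.comp_def, simplexMap_coords] using h
  -- Currying moves the question to the realization itself, where the weak topology applies;
  -- uncurrying is continuous because `I` is locally compact.
  let F : Realization K → C(I, Y) := fun x => ⟨fun t => f (t, x), hx x⟩
  have hF : Continuous F := by
    refine continuous_of_simplexMap fun s hs => ?_
    exact ContinuousMap.continuous_of_continuous_uncurry _ ((hf s hs).comp continuous_swap)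
  exact (ContinuousMap.continuous_uncurry_of_continuous ⟨F, hF⟩).comp continuous_swap

/-- The point of a realization with given unnormalized barycentric coordinates. -/
noncomputable def ofWeights (w : ι →₀ ℝ≥0) (hw : w.support ∈ K) : Realization K :=
  ⟨w.mapRange (fun a : ℝ≥0 => (a : ℝ) / ((∑ i ∈ w.support, w i : ℝ≥0) : ℝ)) (by simp), by
    have hT : (0 : ℝ) < ((∑ i ∈ w.support, w i : ℝ≥0) : ℝ) :=
      NNReal.coe_pos.2 (Finset.sum_pos
        (fun i hi => pos_iff_ne_zero.2 (Finsupp.mem_support_iff.1 hi)) (nonempty_of_mem hw))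
    refine ⟨fun i => by simp only [Finsupp.mapRange_apply]; positivity, ?_, ?_⟩
    · rw [Finsupp.sum_mapRange_index (fun _ => rfl), Finsupp.sum, ← Finset.sum_div,
        ← NNReal.coe_sum, div_self hT.ne']
    · rwa [Finsupp.support_mapRange_of_injective]
      exact fun a b h => NNReal.coe_injective ((div_left_inj' hT.ne').1 h)⟩

theorem ofWeights_apply (w : ι →₀ ℝ≥0) (hw : w.support ∈ K) (i : ι) :
    (ofWeights w hw).1 i = (w i : ℝ) / ((∑ i ∈ w.support, w i : ℝ≥0) : ℝ) := rfl

theorem support_ofWeights (w : ι →₀ ℝ≥0) (hw : w.support ∈ K) :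
    (ofWeights w hw).1.support ⊆ w.support :=
  Finsupp.support_mapRange (hf := by simp)

theorem ofWeights_eq (w : ι →₀ ℝ≥0) (hw : w.support ∈ K) (x : Realization K)
    (h : ∀ i, (w i : ℝ) = x.1 i) : ofWeights w hw = x := by
  have hs : w.support = x.1.support := by
    ext i
    simp [← h]
  refine Subtype.ext (Finsupp.ext fun i => ?_)
  have hT : ((∑ i ∈ w.support, w i : ℝ≥0) : ℝ) = 1 := by
    rw [NNReal.coe_sum, hs]
    exact (Finset.sum_congr rfl fun i _ => h i).trans x.2.2.1
  rw [ofWeights_apply, hT, div_one, h]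

theorem continuous_ofWeights {Z : Type*} [TopologicalSpace Z] {w : Z → ι →₀ ℝ≥0}
    (hw : ∀ z, (w z).support ∈ K) (S : Finset ι) (hS : ∀ z, (w z).support ⊆ S)
    (hc : ∀ i, Continuous fun z => w z i) : Continuous fun z => ofWeights (w z) (hw z) := by
  refine continuous_of_coord S (fun z => (support_ofWeights _ _).trans (hS z)) fun i => ?_
  have hsum : ∀ z, ∑ i ∈ (w z).support, w z i = ∑ i ∈ S, w z i := fun z =>
    Finset.sum_subset (hS z) fun i _ hi => Finsupp.notMem_support_iff.1 hi
  simp_rw [ofWeights_apply, hsum]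
  refine (NNReal.continuous_coe.comp (hc i)).div
    (NNReal.continuous_coe.comp (continuous_finsetSum _ fun i _ => hc i)) fun z => ?_
  rw [← hsum, NNReal.coe_ne_zero]
  exact (Finset.sum_pos (fun i hi => pos_iff_ne_zero.2 (Finsupp.mem_support_iff.1 hi))
    (nonempty_of_mem (hw z))).ne'

/-- Pushing forward along an injective vertex map the point whose weights are pulled back. -/
theorem ofWeights_comapDomain {L : AbstractSimplicialComplex κ} (f : ι → κ)
    (φ : Realization K → Realization L) (hφ : ∀ x, (φ x).1 = x.1.mapDomain f)
    (hinj : Function.Injective f)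
    (w : κ →₀ ℝ≥0) (hw : w.support ∈ L) (hw' : (w.comapDomain f hinj.injOn).support ∈ K)
    (hr : ↑w.support ⊆ Set.range f) :
    φ (ofWeights (w.comapDomain f hinj.injOn) hw') = ofWeights w hw := by
  classical
  refine Subtype.ext (Finsupp.ext fun k => ?_)
  rw [hφ]
  have hsum : ∑ i ∈ (w.comapDomain f hinj.injOn).support, w.comapDomain f hinj.injOn i =
      ∑ k ∈ w.support, w k :=
    Finsupp.sum_comapDomain f w (fun _ a => a)
      ⟨Set.mapsTo_preimage _ _, hinj.injOn, fun k hk => by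
        obtain ⟨i, rfl⟩ := hr hk
        exact ⟨i, hk, rfl⟩⟩
  by_cases hk : k ∈ Set.range f
  · obtain ⟨i, rfl⟩ := hk
    rw [Finsupp.mapDomain_apply hinj, ofWeights_apply, ofWeights_apply, hsum]
    rfl
  · rw [Finsupp.mapDomain_of_notMem_range _ _ hk, ofWeights_apply,
      Finsupp.notMem_support_iff.1 fun h => hk (hr h)]
    simp

end Realization

/-! ### Splitting a weighted chain at its median. -/

namespace ChainWeights

variable {P : Type u} [PartialOrder P] {V : Type w}

open Classical in
/-- The total weight of the elements of `S` above `a`. -/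
noncomputable def upperMass (S : Finset P) (x : P → ℝ≥0) (a : P) : ℝ≥0 :=
  ∑ k ∈ S with a ≤ k, x k

open Classical in
/-- The total weight of the elements of `S` strictly above `a`. -/
noncomputable def strictUpperMass (S : Finset P) (x : P → ℝ≥0) (a : P) : ℝ≥0 :=
  ∑ k ∈ S with a < k, x k

/-- Weights supported on the elements of a chain that do not lie above the median. -/
noncomputable def lowWeight (S : Finset P) (x : P → ℝ≥0) (a : P) : ℝ≥0 :=
  x a * (upperMass S x a - 1 / 2)

/-- Weights supported on the elements of a chain that do not lie below the median. -/
noncomputable def highWeight (S : Finset P) (x : P → ℝ≥0) (a : P) : ℝ≥0 :=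
  x a * (1 / 2 - strictUpperMass S x a)

section Mass

variable {S : Finset P} {x : P → ℝ≥0}

/-- If `b < a`, all mass at or above `a` lies strictly above `b`. The first mass exceeds 1/2 when
the low weight of `a` is nonzero, the second is below 1/2 when the high weight of `b` is nonzero. -/
theorem le_of_lowWeight_of_highWeight (hS : IsChain (· ≤ ·) (S : Set P)) {a b : P} (ha : a ∈ S)
    (hb : b ∈ S) (hla : lowWeight S x a ≠ 0) (hhb : highWeight S x b ≠ 0) : a ≤ b := by
  classical
  by_contra hab
  have hba : b < a := lt_of_le_not_ge ((hS.total ha hb).resolve_left hab) hab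
  have h1 : 1 / 2 < upperMass S x a := by
    by_contra h
    exact hla (by rw [lowWeight, tsub_eq_zero_of_le (not_lt.1 h), mul_zero])
  have h2 : strictUpperMass S x b < 1 / 2 := by
    by_contra h
    exact hhb (by rw [highWeight, tsub_eq_zero_of_le (not_lt.1 h), mul_zero])
  have h3 : upperMass S x a ≤ strictUpperMass S x b :=
    Finset.sum_le_sum_of_subset fun k hk => by
      rw [Finset.mem_filter] at hk ⊢
      exact ⟨hk.1, hba.trans_le hk.2⟩
  exact (h1.trans_le (h3.trans h2.le)).false

theorem exists_lowWeight_ne_zero (hS : IsChain (· ≤ ·) (S : Set P)) (hne : S.Nonempty)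
    (hx : ∀ a ∈ S, x a ≠ 0) (hsum : ∑ a ∈ S, x a = 1) : ∃ a ∈ S, lowWeight S x a ≠ 0 := by
  classical
  obtain ⟨a, ha⟩ := S.exists_minimal hne
  refine ⟨a, ha.prop, mul_ne_zero (hx a ha.prop) ?_⟩
  have : upperMass S x a = 1 := by
    rw [upperMass, Finset.filter_true_of_mem, hsum]
    exact fun b hb => (hS.total ha.prop hb).elim id fun h => ha.le_of_le hb h
  rw [this]
  exact (tsub_pos_of_lt (by norm_num)).ne'

theorem exists_highWeight_ne_zero (hne : S.Nonempty) (hx : ∀ a ∈ S, x a ≠ 0) :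
    ∃ a ∈ S, highWeight S x a ≠ 0 := by
  classical
  obtain ⟨a, ha⟩ := S.exists_maximal hne
  refine ⟨a, ha.prop, mul_ne_zero (hx a ha.prop) ?_⟩
  have : strictUpperMass S x a = 0 := by
    rw [strictUpperMass, Finset.filter_false_of_mem, Finset.sum_empty]
    exact fun b hb => ha.not_gt hb
  rw [this]
  norm_num

end Mass

/-! ### The deformation in coordinates: functions on vertices and their superlevel sets. -/

section Blend

variable (e : P ↪o Finset V) (E : P → V → V)

open Classical in
/-- The function on vertices obtained by giving each face `e a` its low weight. -/
noncomputable def spread (S : Finset P) (x : P → ℝ≥0) (f : V) : ℝ≥0 :=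
  ∑ a ∈ S, lowWeight S x a * if f ∈ e a then 1 else 0

open Classical in
/-- The function on vertices obtained by pushing low faces forward along the maps attached to
high faces. -/
noncomputable def push (S : Finset P) (x : P → ℝ≥0) (g : V) : ℝ≥0 :=
  ∑ a ∈ S, ∑ b ∈ S, ∑ f ∈ e a,
    lowWeight S x a * highWeight S x b * if E b f = g then 1 else 0

/-- The interpolation between `spread` and `push`. -/
noncomputable def blend (S : Finset P) (x : P → ℝ≥0) (t : ℝ≥0) (f : V) : ℝ≥0 :=
  (1 - t) * spread e S x f + (2 * t - 1) * push e E S x f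

open Classical in
/-- A finite set of vertices that contains the support of `blend`. -/
noncomputable def carrier (S : Finset P) : Finset V :=
  S.biUnion e ∪ S.biUnion fun a => S.biUnion fun b => (e a).image (E b)

open Classical in
/-- A weight on faces, positive exactly on the superlevel sets of `y`. -/
noncomputable def levelWeight (F : Finset V) (y : V → ℝ≥0) (a : P) : ℝ≥0 :=
  ∏ f ∈ e a, (y f - (F \ e a).sup y)

/-- The unnormalized barycentric coordinates of the deformation. -/
noncomputable def weight (S : Finset P) (x : P → ℝ≥0) (t : ℝ≥0) (a : P) : ℝ≥0 :=
  -- Subtraction is truncated: the original coordinates vanish from time 1/2 on, while the pushed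
  -- part of `blend` appears only after time 1/2. The two therefore never coexist, which
  -- `isChain_weight` needs.
  (1 - 2 * t) * x a + t * levelWeight e (carrier e E S) (blend e E S x t) a

section Basic

variable {e E} {S : Finset P} {x : P → ℝ≥0}

theorem spread_ne_zero_iff {f : V} :
    spread e S x f ≠ 0 ↔ ∃ a ∈ S, lowWeight S x a ≠ 0 ∧ f ∈ e a := by
  simp [spread, Finset.sum_eq_zero_iff, and_comm]

theorem push_ne_zero_iff {g : V} :
    push e E S x g ≠ 0 ↔ ∃ a ∈ S, ∃ b ∈ S, ∃ f ∈ e a,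
      lowWeight S x a ≠ 0 ∧ highWeight S x b ≠ 0 ∧ E b f = g := by
  simp only [push, ne_eq, Finset.sum_eq_zero_iff, mul_eq_zero, ite_eq_right_iff, one_ne_zero,
    imp_false, not_forall, not_or, not_not, exists_prop, and_assoc]

theorem mem_carrier {g : V} :
    g ∈ carrier e E S ↔ (∃ a ∈ S, g ∈ e a) ∨ ∃ a ∈ S, ∃ b ∈ S, ∃ f ∈ e a, E b f = g := by
  simp [carrier]

theorem mem_carrier_of_blend_ne_zero {t : ℝ≥0} {g : V} (h : blend e E S x t g ≠ 0) :
    g ∈ carrier e E S := by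
  rw [mem_carrier]
  by_cases hs : spread e S x g = 0
  · have hp : push e E S x g ≠ 0 := fun hp => h (by rw [blend, hs, hp, mul_zero, mul_zero, add_zero])
    obtain ⟨a, ha, b, hb, f, hf, -, -, h⟩ := push_ne_zero_iff.1 hp
    exact Or.inr ⟨a, ha, b, hb, f, hf, h⟩
  · obtain ⟨a, ha, -, h⟩ := spread_ne_zero_iff.1 hs
    exact Or.inl ⟨a, ha, h⟩

/-- Each factor is positive iff its vertex beats every competitor in `F` outside the face and the
value 0; since `y` vanishes off `F`, these are all the competitors. -/
theorem levelWeight_ne_zero_iff {F : Finset V} {y : V → ℝ≥0} (hy : ∀ f, y f ≠ 0 → f ∈ F) {a : P} :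
    levelWeight e F y a ≠ 0 ↔ ∀ f ∈ e a, y f ≠ 0 ∧ ∀ g ∉ e a, y g < y f := by
  classical
  rw [levelWeight, Finset.prod_ne_zero_iff]
  refine forall₂_congr fun f hf => ?_
  rw [← pos_iff_ne_zero, tsub_pos_iff_lt]
  constructor
  · intro h
    refine ⟨(pos_of_gt h).ne', fun g hg => ?_⟩
    by_cases hgF : g ∈ F
    · exact (Finset.le_sup (f := y) (Finset.mem_sdiff.2 ⟨hgF, hg⟩)).trans_lt h
    · rw [not_not.1 (mt (hy g) hgF)]
      exact pos_of_gt h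
  · rintro ⟨h0, h⟩
    exact (Finset.sup_lt_iff (pos_iff_ne_zero.2 h0)).2 fun g hg => h g (Finset.mem_sdiff.1 hg).2

/-- Allows one fixed finite `S` to be used for all points of a closed simplex, although their
supports jump. Continuity of the deformation rests on this. -/
theorem weight_congr {S' : Finset P} (hS : S ⊆ S') (hx : ∀ a, a ∉ S → x a = 0) (t : ℝ≥0) :
    weight e E S x t = weight e E S' x t := by
  classical
  have hl : lowWeight S x = lowWeight S' x := by
    funext a
    rw [lowWeight, lowWeight, upperMass, upperMass, Finset.sum_filter, Finset.sum_filter,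
      Finset.sum_subset hS fun k _ hk => by rw [hx k hk, ite_self]]
  have hh : highWeight S x = highWeight S' x := by
    funext a
    rw [highWeight, highWeight, strictUpperMass, strictUpperMass, Finset.sum_filter,
      Finset.sum_filter, Finset.sum_subset hS fun k _ hk => by rw [hx k hk, ite_self]]
  have hl0 : ∀ a, a ∉ S → lowWeight S' x a = 0 := fun a ha => by rw [lowWeight, hx a ha, zero_mul]
  have hh0 : ∀ a, a ∉ S → highWeight S' x a = 0 := fun a ha => by
    rw [highWeight, hx a ha, zero_mul]
  have hb : blend e E S x t = blend e E S' x t := by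
    funext f
    have h1 : spread e S x f = spread e S' x f := by
      rw [spread, spread, hl]
      exact Finset.sum_subset hS fun a _ ha => by rw [hl0 a ha, zero_mul]
    have h2 : push e E S x f = push e E S' x f := by
      rw [push, push, hl, hh, Finset.sum_subset hS fun a _ ha => by simp [hl0 a ha]]
      refine Finset.sum_congr rfl fun a _ => Finset.sum_subset hS fun b _ hb => by simp [hh0 b hb]
    rw [blend, blend, h1, h2]
  have hF : carrier e E S ⊆ carrier e E S' := by
    intro g hg
    rw [mem_carrier] at hg ⊢
    rcases hg with ⟨a, ha, h⟩ | ⟨a, ha, b, hb, h⟩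
    exacts [Or.inl ⟨a, hS ha, h⟩, Or.inr ⟨a, hS ha, b, hS hb, h⟩]
  funext a
  have hsup : ∀ y : V → ℝ≥0, (∀ f, y f ≠ 0 → f ∈ carrier e E S) →
      (carrier e E S \ e a).sup y = (carrier e E S' \ e a).sup y := fun y hy => by
    refine le_antisymm (Finset.sup_mono (Finset.sdiff_subset_sdiff hF subset_rfl))
      (Finset.sup_le fun f hf => ?_)
    by_cases h0 : y f = 0
    · rw [h0]
      exact zero_le
    · exact Finset.le_sup (f := y) (Finset.mem_sdiff.2 ⟨hy f h0, (Finset.mem_sdiff.1 hf).2⟩)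
  rw [weight, weight, levelWeight, levelWeight, ← hb,
    hsup _ fun f hf => mem_carrier_of_blend_ne_zero hf]

theorem continuous_weight {Z : Type*} [TopologicalSpace Z] {X : Z → P → ℝ≥0} {t : Z → ℝ≥0}
    (hX : ∀ a, Continuous fun z => X z a) (ht : Continuous t) (a : P) :
    Continuous fun z => weight e E S (X z) (t z) a := by
  classical
  have hl : ∀ a, Continuous fun z => lowWeight S (X z) a := fun a => by
    unfold lowWeight upperMass
    fun_prop
  have hh : ∀ a, Continuous fun z => highWeight S (X z) a := fun a => by
    unfold highWeight strictUpperMass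
    fun_prop
  have hb : ∀ f, Continuous fun z => blend e E S (X z) (t z) f := fun f => by
    unfold blend spread push
    fun_prop
  unfold weight levelWeight
  refine ((continuous_const.sub (continuous_const.mul ht)).mul (hX a)).add (ht.mul ?_)
  exact continuous_finsetProd _ fun f _ => (hb f).sub
    (Continuous.finset_sup_apply fun g _ => hb g)

/-- A finite set containing the support of `weight`. -/
noncomputable def weightSupport (e : P ↪o Finset V) (E : P → V → V) (S : Finset P) : Finset P :=
  open Classical in S ∪ (carrier e E S).powerset.preimage e e.injective.injOn

theorem mem_weightSupport (hx : ∀ a, a ∉ S → x a = 0) {t : ℝ≥0} {a : P}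
    (h : weight e E S x t a ≠ 0) : a ∈ weightSupport e E S := by
  classical
  rw [weightSupport, Finset.mem_union, Finset.mem_preimage, Finset.mem_powerset]
  by_cases ha : a ∈ S
  · exact Or.inl ha
  · refine Or.inr fun f hf => ?_
    have hl : levelWeight e (carrier e E S) (blend e E S x t) a ≠ 0 := fun hl =>
      h (by rw [weight, hx a ha, hl, mul_zero, mul_zero, add_zero])
    exact mem_carrier_of_blend_ne_zero
      ((levelWeight_ne_zero_iff fun f hf => mem_carrier_of_blend_ne_zero hf).1 hl f hf).1

end Basic

section Chain

variable {e E} {S : Finset P} {x : P → ℝ≥0}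

theorem weight_zero (a : P) : weight e E S x 0 a = x a := by
  simp [weight]

/-- A face of positive weight has positive weight to begin with or is a superlevel set. -/
theorem ne_zero_of_weight_ne_zero {t : ℝ≥0} {a : P} (h : weight e E S x t a ≠ 0) :
    (x a ≠ 0 ∧ 2 * t < 1) ∨
      ∀ f ∈ e a, blend e E S x t f ≠ 0 ∧ ∀ g ∉ e a, blend e E S x t g < blend e E S x t f := by
  by_cases hl : levelWeight e (carrier e E S) (blend e E S x t) a = 0
  · refine Or.inl ?_
    rw [weight, hl, mul_zero, add_zero, mul_ne_zero_iff] at h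
    exact ⟨h.2, tsub_pos_iff_lt.1 (pos_iff_ne_zero.2 h.1)⟩
  · exact Or.inr
      ((levelWeight_ne_zero_iff fun f hf => mem_carrier_of_blend_ne_zero hf).1 hl)

/-- Superlevel sets of one function are nested. -/
theorem le_total_of_level {y : V → ℝ≥0} {a b : P} (ha : ∀ f ∈ e a, ∀ g ∉ e a, y g < y f)
    (hb : ∀ f ∈ e b, ∀ g ∉ e b, y g < y f) : a ≤ b ∨ b ≤ a := by
  by_contra! h
  rw [← e.le_iff_le, ← e.le_iff_le,
    Finset.not_subset, Finset.not_subset] at h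
  obtain ⟨⟨f, hfa, hfb⟩, g, hgb, hga⟩ := h
  exact (ha f hfa g hga).asymm (hb g hgb f hfb)

/-- Before time 1/2 only `spread`, a combination of indicators of members of the chain `S`,
contributes. If `f` beats `g`, some `k ∈ S` contains `f` but not `g`; comparing `k` with `a`
excludes `g ∈ a`, `f ∉ a`. -/
theorem le_total_of_mem_of_level (hS : IsChain (· ≤ ·) (S : Set P)) {t : ℝ≥0} (ht : 2 * t < 1)
    {a b : P} (ha : a ∈ S)
    (hb : ∀ f ∈ e b, ∀ g ∉ e b, blend e E S x t g < blend e E S x t f) : a ≤ b ∨ b ≤ a := by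
  by_contra! h
  rw [← e.le_iff_le, ← e.le_iff_le,
    Finset.not_subset, Finset.not_subset] at h
  obtain ⟨⟨g, hga, hgb⟩, f, hfb, hfa⟩ := h
  have hlt := hb f hfb g hgb
  rw [blend, blend, tsub_eq_zero_of_le ht.le, zero_mul, zero_mul, add_zero, add_zero] at hlt
  have hlt : spread e S x g < spread e S x f := lt_of_mul_lt_mul_left' hlt
  obtain ⟨k, hk, hk'⟩ := Finset.exists_lt_of_sum_lt hlt
  have hfk : f ∈ e k := by
    by_contra hfk
    rw [if_neg hfk, mul_zero] at hk'
    exact not_lt_zero hk'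
  have hgk : g ∉ e k := by
    intro hgk
    rw [if_pos hfk, if_pos hgk] at hk'
    exact hk'.false
  rcases hS.total ha hk with hak | hka
  · exact hgk (e.monotone hak hga)
  · exact hfa (e.monotone hka hfk)

theorem isChain_weight (hS : IsChain (· ≤ ·) (S : Set P)) (hx : ∀ a, x a ≠ 0 → a ∈ S)
    (t : ℝ≥0) : IsChain (· ≤ ·) {a | weight e E S x t a ≠ 0} := by
  intro a ha b hb _
  rcases ne_zero_of_weight_ne_zero ha with ⟨ha, ht⟩ | ha <;>
    rcases ne_zero_of_weight_ne_zero hb with ⟨hb, ht'⟩ | hb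
  · exact hS.total (hx a ha) (hx b hb)
  · exact le_total_of_mem_of_level hS ht (hx a ha) fun f hf => (hb f hf).2
  · exact (le_total_of_mem_of_level hS ht' (hx b hb) fun f hf => (ha f hf).2).symm
  · exact le_total_of_level (fun f hf => (ha f hf).2) fun f hf => (hb f hf).2

/-- Take the largest low face. It contains all low faces and lies below all high ones, so `hE`
yields a face containing it and all its pushed vertices. -/
theorem exists_superset_blend (hS : IsChain (· ≤ ·) (S : Set P))
    (hE : ∀ (a : P) (J : Finset P), (∀ j ∈ J, a ≤ j) →
      ∃ b : P, e a ⊆ e b ∧ ∀ j ∈ J, ∀ f ∈ e a, E j f ∈ e b)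
    (h0 : ∃ a ∈ S, lowWeight S x a ≠ 0) (t : ℝ≥0) :
    ∃ b : P, ∀ f, blend e E S x t f ≠ 0 → f ∈ e b := by
  classical
  obtain ⟨a, ha⟩ := (S.filter (lowWeight S x · ≠ 0)).exists_maximal
    (h0.imp fun a h => Finset.mem_filter.2 h)
  have hmem := Finset.mem_filter.1 ha.prop
  have hmax : ∀ a' ∈ S, lowWeight S x a' ≠ 0 → a' ≤ a := fun a' ha' hl =>
    (hS.total ha' hmem.1).elim id fun h => ha.le_of_ge (Finset.mem_filter.2 ⟨ha', hl⟩) h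
  obtain ⟨b, hab, hb⟩ := hE a (S.filter (highWeight S x · ≠ 0)) fun j hj =>
    le_of_lowWeight_of_highWeight hS hmem.1 (Finset.mem_filter.1 hj).1 hmem.2
      (Finset.mem_filter.1 hj).2
  refine ⟨b, fun g hg => ?_⟩
  by_cases hs : spread e S x g = 0
  · have hp : push e E S x g ≠ 0 := fun hp =>
      hg (by rw [blend, hs, hp, mul_zero, mul_zero, add_zero])
    obtain ⟨a', ha', j, hj, f, hf, hl, hh, rfl⟩ := push_ne_zero_iff.1 hp
    exact hb j (Finset.mem_filter.2 ⟨hj, hh⟩) f (e.monotone (hmax a' ha' hl) hf)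
  · obtain ⟨a', ha', hl, hf⟩ := spread_ne_zero_iff.1 hs
    exact hab (e.monotone (hmax a' ha' hl) hf)

theorem exists_blend_ne_zero (hne : ∀ a, (e a).Nonempty) (hl : ∃ a ∈ S, lowWeight S x a ≠ 0)
    (hh : ∃ b ∈ S, highWeight S x b ≠ 0) {t : ℝ≥0} (ht : t ≤ 1) :
    ∃ f, blend e E S x t f ≠ 0 := by
  obtain ⟨a, ha, hla⟩ := hl
  obtain ⟨b, hb, hhb⟩ := hh
  obtain ⟨f, hf⟩ := hne a
  rcases ht.lt_or_eq with ht | rfl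
  · refine ⟨f, fun h => ?_⟩
    rw [blend, add_eq_zero, mul_eq_zero] at h
    exact h.1.elim (tsub_pos_iff_lt.2 ht).ne' (spread_ne_zero_iff.2 ⟨a, ha, hla, hf⟩)
  · refine ⟨E b f, fun h => ?_⟩
    rw [blend, add_eq_zero, mul_eq_zero (a := 2 * 1 - 1)] at h
    refine h.2.elim (tsub_pos_iff_lt.2 (by norm_num)).ne'
      (push_ne_zero_iff.2 ⟨a, ha, b, hb, f, hf, hla, hhb, rfl⟩)

/-- For `t > 0`, the set where `blend` attains its maximum is a nonempty part of a face, hence a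
face, and it is a superlevel set. -/
theorem exists_weight_ne_zero (hS : IsChain (· ≤ ·) (S : Set P)) (hSne : S.Nonempty)
    (hx : ∀ a ∈ S, x a ≠ 0) (hsum : ∑ a ∈ S, x a = 1) (hne : ∀ a, (e a).Nonempty)
    (hlower : ∀ (a : P) (s : Finset V), s ⊆ e a → s.Nonempty → ∃ b, e b = s)
    (hE : ∀ (a : P) (J : Finset P), (∀ j ∈ J, a ≤ j) →
      ∃ b : P, e a ⊆ e b ∧ ∀ j ∈ J, ∀ f ∈ e a, E j f ∈ e b) {t : ℝ≥0} (ht : t ≤ 1) :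
    ∃ a, weight e E S x t a ≠ 0 := by
  classical
  rcases eq_or_ne t 0 with rfl | ht0
  · obtain ⟨a, ha⟩ := hSne
    exact ⟨a, by rw [weight_zero]; exact hx a ha⟩
  have hl := exists_lowWeight_ne_zero hS hSne hx hsum
  obtain ⟨f, hf⟩ := exists_blend_ne_zero (e := e) (E := E) hne hl
    (exists_highWeight_ne_zero hSne hx) ht
  obtain ⟨b, hb⟩ := exists_superset_blend hS hE hl t
  set y := blend e E S x t with hy
  obtain ⟨m, hm, hmax⟩ := (e b).exists_max_image y ⟨f, hb f hf⟩
  have hm0 : 0 < y m := (pos_iff_ne_zero.2 hf).trans_le (hmax f (hb f hf))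
  obtain ⟨a, ha⟩ := hlower b {g ∈ e b | y g = y m} (Finset.filter_subset _ _)
    ⟨m, Finset.mem_filter.2 ⟨hm, rfl⟩⟩
  refine ⟨a, fun h => ?_⟩
  rw [weight, add_eq_zero, mul_eq_zero (a := t)] at h
  refine h.2.elim ht0 ((levelWeight_ne_zero_iff fun f hf =>
    mem_carrier_of_blend_ne_zero hf).2 fun g hg => ?_)
  rw [ha, Finset.mem_filter] at hg
  refine ⟨by rw [← hy, hg.2]; exact hm0.ne', fun k hk => ?_⟩
  rw [← hy, hg.2]
  by_cases hk0 : y k = 0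
  · rwa [hk0]
  · refine lt_of_le_of_ne (hmax k (hb k hk0)) fun h => hk ?_
    rw [ha]
    exact Finset.mem_filter.2 ⟨hb k hk0, h⟩

/-- Keeps the deformation inside the subcomplex on `A` when it starts there: spread vertices come
from faces of the original point, pushed ones land in `A` by `hEA`. -/
theorem subset_of_weight_ne_zero {A : Set V} (hx : ∀ a, x a ≠ 0 → ↑(e a) ⊆ A)
    (hEA : ∀ j, ∀ f ∈ e j, E j f ∈ A) (hS : IsChain (· ≤ ·) (S : Set P))
    {t : ℝ≥0} {a : P} (h : weight e E S x t a ≠ 0) : ↑(e a) ⊆ A := by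
  rcases ne_zero_of_weight_ne_zero h with ⟨ha, -⟩ | ha
  · exact hx a ha
  intro g hg
  by_cases hs : spread e S x g = 0
  · have hp : push e E S x g ≠ 0 := fun hp =>
      (ha g hg).1 (by rw [blend, hs, hp, mul_zero, mul_zero, add_zero])
    obtain ⟨a', ha', j, hj, f, hf, hl, hh, rfl⟩ := push_ne_zero_iff.1 hp
    exact hEA j f (e.monotone (le_of_lowWeight_of_highWeight hS ha' hj hl hh) hf)
  · obtain ⟨a', -, hl, hf⟩ := spread_ne_zero_iff.1 hs
    exact hx a' (left_ne_zero_of_mul hl) hf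

/-- At time 1 only pushed vertices remain, so the end of the deformation lies over `A` wherever it
began. -/
theorem subset_of_weight_one_ne_zero {A : Set V} (hEA : ∀ j, ∀ f ∈ e j, E j f ∈ A)
    (hS : IsChain (· ≤ ·) (S : Set P)) {a : P} (h : weight e E S x 1 a ≠ 0) : ↑(e a) ⊆ A := by
  rcases ne_zero_of_weight_ne_zero h with ⟨-, ht⟩ | ha
  · norm_num at ht
  intro g hg
  have hp : push e E S x g ≠ 0 := fun hp => (ha g hg).1 (by simp [blend, hp])
  obtain ⟨a', ha', j, hj, f, hf, hl, hh, rfl⟩ := push_ne_zero_iff.1 hp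
  exact hEA j f (e.monotone (le_of_lowWeight_of_highWeight hS ha' hj hl hh) hf)

end Chain

end Blend

end ChainWeights

namespace Realization

variable {ι : Type u} {K : AbstractSimplicialComplex ι}

theorem continuous_coord (i : ι) : Continuous fun x : Realization K => x.1 i :=
  continuous_of_simplexMap fun s hs => continuous_simplexMap_apply s hs i

/-- The barycentric coordinates as nonnegative real numbers. -/
def nnCoord (x : Realization K) (i : ι) : ℝ≥0 := ⟨x.1 i, x.2.1 i⟩

theorem continuous_nnCoord (i : ι) : Continuous fun x : Realization K => x.nnCoord i :=
  continuous_induced_rng.2 (continuous_coord i)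

theorem nnCoord_ne_zero_iff (x : Realization K) (i : ι) : x.nnCoord i ≠ 0 ↔ i ∈ x.1.support := by
  rw [Finsupp.mem_support_iff, ← NNReal.coe_ne_zero]
  rfl

theorem nnCoord_eq_zero {x : Realization K} {i : ι} (h : i ∉ x.1.support) : x.nnCoord i = 0 :=
  not_not.1 (mt (nnCoord_ne_zero_iff x i).1 h)

theorem sum_nnCoord (x : Realization K) : ∑ i ∈ x.1.support, x.nnCoord i = 1 := by
  rw [← NNReal.coe_inj, NNReal.coe_sum]
  exact x.2.2.1

end Realization

open Realization ChainWeights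

/-! ### The homotopy equivalence criterion. -/

section Deformation

variable {P : Type u} [PartialOrder P] {V : Type w} (e : P ↪o Finset V) (E : P → V → V)

/-- The unnormalized coordinates of the deformation of a point of a classifying space. -/
noncomputable def deformWeight (x : ClassifyingSpace P) (t : I) : P →₀ ℝ≥0 :=
  Finsupp.onFinset (weightSupport e E x.1.support)
    (weight e E x.1.support x.nnCoord (unitInterval.toNNReal t))
    fun _ => mem_weightSupport fun _ => nnCoord_eq_zero

variable {e E}

theorem deformWeight_apply_of_subset {x : ClassifyingSpace P} {S : Finset P}
    (hS : x.1.support ⊆ S) (t : I) (a : P) :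
    deformWeight e E x t a = weight e E S x.nnCoord (unitInterval.toNNReal t) a :=
  congrFun (weight_congr hS (fun _ => nnCoord_eq_zero) _) a

theorem deformWeight_zero (x : ClassifyingSpace P) (a : P) :
    (deformWeight e E x 0 a : ℝ) = x.1 a := by
  have h : unitInterval.toNNReal 0 = 0 := rfl
  rw [deformWeight_apply_of_subset subset_rfl, h, weight_zero]
  rfl

theorem isChain_support_deformWeight (x : ClassifyingSpace P) (t : I) :
    IsChain (· ≤ ·) ((deformWeight e E x t).support : Set P) :=
  (isChain_weight x.2.2.2.2 (fun a => (nnCoord_ne_zero_iff x a).1)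
    (unitInterval.toNNReal t)).mono fun _ ha => Finsupp.mem_support_iff.1 ha

theorem support_deformWeight_mem (hne : ∀ a, (e a).Nonempty)
    (hlower : ∀ (a : P) (s : Finset V), s ⊆ e a → s.Nonempty → ∃ b, e b = s)
    (hE : ∀ (a : P) (J : Finset P), (∀ j ∈ J, a ≤ j) →
      ∃ b : P, e a ⊆ e b ∧ ∀ j ∈ J, ∀ f ∈ e a, E j f ∈ e b) (x : ClassifyingSpace P) (t : I) :
    (deformWeight e E x t).support ∈ orderComplex P := by
  refine ⟨?_, isChain_support_deformWeight x t⟩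
  obtain ⟨a, ha⟩ := exists_weight_ne_zero (e := e) (E := E) x.2.2.2.2 x.2.2.2.1
    (fun a ha => (nnCoord_ne_zero_iff x a).2 ha) x.sum_nnCoord hne hlower hE
    (t := unitInterval.toNNReal t) t.2.2
  exact ⟨a, Finsupp.mem_support_iff.2 ha⟩

theorem continuous_ofWeights_deformWeight {κ : Type v} {L : AbstractSimplicialComplex κ}
    {Z : Type*} [TopologicalSpace Z] {x : Z → ClassifyingSpace P} (hx : Continuous x)
    {S : Finset P} (hS : ∀ z, (x z).1.support ⊆ S) {t : Z → I} (ht : Continuous t)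
    {f : κ → P} (hf : Function.Injective f) {w : Z → κ →₀ ℝ≥0} (hL : ∀ z, (w z).support ∈ L)
    (hw : ∀ z k, w z k = deformWeight e E (x z) (t z) (f k)) :
    Continuous fun z => ofWeights (w z) (hL z) := by
  refine continuous_ofWeights hL ((weightSupport e E S).preimage f hf.injOn)
    (fun z k hk => ?_) fun k => ?_
  · rw [Finsupp.mem_support_iff, hw, deformWeight_apply_of_subset (hS z)] at hk
    exact Finset.mem_preimage.2
      (mem_weightSupport (fun a ha => nnCoord_eq_zero fun h => ha (hS z h)) hk)
  · simp_rw [hw, deformWeight_apply_of_subset (hS _)]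
    exact continuous_weight (fun a => (continuous_nnCoord a).comp hx)
      (unitInterval.toNNReal_continuous.comp ht) _

/-- Let `P` be the face poset of a simplicial complex with vertices in `V`, given by `e`, and let
`Q` be the face poset of the full subcomplex on `A`. Suppose that for each face `j` a map `E j`
moves the vertices of `j` into `A`, such that each face `a` spans a common face with its images
under the maps `E j` for any finitely many `j` containing `a`. Then the inclusion `Q → P` is a
homotopy equivalence. -/
theorem isPosetHomotopyEquiv_of_push {Q : Type v} [PartialOrder Q] (i : Q →o P)
    (hi : ∀ q q', i q ≤ i q' → q ≤ q') {A : Set V} (hA : ∀ a, a ∈ Set.range i ↔ ↑(e a) ⊆ A)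
    (hne : ∀ a, (e a).Nonempty)
    (hlower : ∀ (a : P) (s : Finset V), s ⊆ e a → s.Nonempty → ∃ b, e b = s)
    (hE : ∀ (a : P) (J : Finset P), (∀ j ∈ J, a ≤ j) →
      ∃ b : P, e a ⊆ e b ∧ ∀ j ∈ J, ∀ f ∈ e a, E j f ∈ e b)
    (hEA : ∀ j, ∀ f ∈ e j, E j f ∈ A) : IsPosetHomotopyEquiv i := by
  classical
  have hinj : Function.Injective i := fun q q' h => le_antisymm (hi _ _ h.le) (hi _ _ h.ge)
  have hP := support_deformWeight_mem (e := e) (E := E) hne hlower hE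
  have hcomap : ∀ (x : ClassifyingSpace P) (t : I),
      (∀ a ∈ (deformWeight e E x t).support, a ∈ Set.range i) →
      ((deformWeight e E x t).comapDomain i hinj.injOn).support ∈ orderComplex Q := by
    intro x t h
    refine ⟨?_, ?_⟩
    · obtain ⟨a, ha⟩ := (hP x t).1
      obtain ⟨q, rfl⟩ := h a ha
      exact ⟨q, by simpa using ha⟩
    · intro q hq q' hq' _
      refine ((isChain_support_deformWeight (e := e) (E := E) x t).total (x := i q) (y := i q') ?_ ?_).imp
        (hi _ _) (hi _ _)
      · simpa using hq
      · simpa using hq'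
  have hsub1 : ∀ (x : ClassifyingSpace P), ∀ a ∈ (deformWeight e E x 1).support,
      a ∈ Set.range i := fun x a ha =>
    (hA a).2 (subset_of_weight_one_ne_zero hEA x.2.2.2.2 (Finsupp.mem_support_iff.1 ha))
  have hsuppi : ∀ y : ClassifyingSpace Q,
      (classifyingMap i y).1.support = y.1.support.image i := fun y =>
    support_mapDomain_of_nonneg i y.1 y.2.1
  have hsubQ : ∀ (y : ClassifyingSpace Q) (t : I),
      ∀ a ∈ (deformWeight e E (classifyingMap i y) t).support, a ∈ Set.range i := by
    intro y t a ha
    refine (hA a).2 (subset_of_weight_ne_zero (fun b hb => (hA b).1 ?_) hEA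
      (classifyingMap i y).2.2.2.2 (Finsupp.mem_support_iff.1 ha))
    rw [nnCoord_ne_zero_iff, hsuppi, Finset.mem_image] at hb
    obtain ⟨q, -, rfl⟩ := hb
    exact ⟨q, rfl⟩
  -- The homotopy inverse is the time 1 map, whose support lies in the range of `i`. The homotopies
  -- `HP` and `HQ` are the deformation and its restriction to the subcomplex.
  let r : C(ClassifyingSpace P, ClassifyingSpace Q) :=
    ⟨fun x => ofWeights _ (hcomap x 1 (hsub1 x)), continuous_of_simplexMap fun s hs =>
      continuous_ofWeights_deformWeight (continuous_simplexMap s hs)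
        (support_simplexMap_subset s hs) continuous_const hinj
        (fun _ => hcomap _ 1 (hsub1 _)) fun _ _ => rfl⟩
  let HP : C(I × ClassifyingSpace P, ClassifyingSpace P) :=
    ⟨fun p => ofWeights _ (hP p.2 p.1), continuous_cylinder_of_simplexMap fun s hs =>
      continuous_ofWeights_deformWeight ((continuous_simplexMap s hs).comp continuous_snd)
        (fun p => support_simplexMap_subset s hs p.2) continuous_fst Function.injective_id
        (fun _ => hP _ _) fun _ _ => rfl⟩
  let HQ : C(I × ClassifyingSpace Q, ClassifyingSpace Q) :=
    ⟨fun p => ofWeights _ (hcomap _ p.1 (hsubQ p.2 p.1)),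
      continuous_cylinder_of_simplexMap fun s hs =>
      continuous_ofWeights_deformWeight (S := s.image i)
        ((classifyingMap i).continuous.comp ((continuous_simplexMap s hs).comp continuous_snd))
        (fun p => by
          rw [Function.comp_apply, hsuppi]
          exact Finset.image_subset_image (support_simplexMap_subset s hs p.2))
        continuous_fst hinj (fun p => hcomap _ p.1 (hsubQ _ p.1)) fun _ _ => rfl⟩
  refine ⟨⟨classifyingMap i, r, ?_, ?_⟩, rfl⟩
  · refine ContinuousMap.Homotopic.symm ⟨⟨HQ, fun y => ?_, fun y => rfl⟩⟩
    refine ofWeights_eq _ (hcomap _ 0 (hsubQ y 0)) _ fun q => ?_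
    rw [Finsupp.comapDomain_apply, deformWeight_zero]
    exact Finsupp.mapDomain_apply hinj y.1 q
  · refine ContinuousMap.Homotopic.symm ⟨⟨HP, fun x => ?_, fun x => ?_⟩⟩
    · exact ofWeights_eq _ (hP x 0) _ fun a => deformWeight_zero x a
    · exact (ofWeights_comapDomain i (classifyingMap i) (fun _ => rfl) hinj _ (hP x 1)
        (hcomap x 1 (hsub1 x)) (hsub1 x)).symm

end Deformation

/-! ### Stable paths as colored maps on the integers. -/

namespace Bigraph

/-- The color of an integer as a vertex of a path bigraph. -/
def parity (k : ℤ) : Fin 2 := if Even k then 0 else 1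

theorem parity_eq_iff (k l : ℤ) : parity k = parity l ↔ k % 2 = l % 2 := by
  unfold parity
  simp only [Int.even_iff]
  split_ifs <;> simp <;> omega

theorem parity_ne_of_adj {k l : ℤ} (h : |k - l| = 1) : parity k ≠ parity l := by
  rw [ne_eq, parity_eq_iff]
  rw [abs_eq (by norm_num)] at h
  omega

/-- The retraction of the infinite path onto `L_{-n,n+1}`. -/
def fold (n : ℕ) (k : ℤ) : (symLine n).graph.V :=
  ⟨if k < -(n : ℤ) then -(n : ℤ) + (k + n) % 2
    else if (n : ℤ) + 1 < k then (n : ℤ) + (k - n) % 2 else k, by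
    constructor <;> split_ifs <;> omega⟩

theorem fold_val (n : ℕ) (k : ℤ) : (fold n k).1 = if k < -(n : ℤ) then -(n : ℤ) + (k + n) % 2
    else if (n : ℤ) + 1 < k then (n : ℤ) + (k - n) % 2 else k := rfl

theorem retraction_val (n : ℕ) (y : (symLine (n + 1)).graph.V) :
    ((retraction n).toFun y).1 =
      if y.1 < -(n : ℤ) then y.1 + 2 else if (n : ℤ) + 1 < y.1 then y.1 - 2 else y.1 := rfl

theorem retraction_fold (n : ℕ) (k : ℤ) : (retraction n).toFun (fold (n + 1) k) = fold n k := by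
  refine Subtype.ext ?_
  rw [retraction_val, fold_val, fold_val]
  push_cast
  split_ifs <;> omega

theorem fold_retraction {n N : ℕ} (h : n ≤ N) (y : (symLine (N + 1)).graph.V) :
    fold n ((retraction N).toFun y).1 = fold n y.1 := by
  refine Subtype.ext ?_
  rw [fold_val, fold_val, retraction_val]
  have h1 := y.2.1
  have h2 := y.2.2
  push_cast at h1 h2
  split_ifs <;> omega

theorem fold_coe (n : ℕ) (y : (symLine n).graph.V) : fold n y.1 = y := by
  refine Subtype.ext ?_
  rw [fold_val, if_neg (not_lt.2 y.2.1), if_neg (not_lt.2 y.2.2)]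

theorem fold_adj (n : ℕ) {k l : ℤ} (h : |k - l| = 1) :
    (symLine n).graph.Adj (fold n k) (fold n l) := by
  change |(fold n k).1 - (fold n l).1| = 1
  rw [fold_val, fold_val]
  rw [abs_eq (by norm_num)] at h ⊢
  split_ifs <;> omega

theorem parity_fold (n : ℕ) (k : ℤ) : parity (fold n k).1 = parity k := by
  rw [parity_eq_iff, fold_val]
  split_ifs <;> omega

theorem edgeInclusion_val (n : ℕ) (k : ℤ) (h1 : -(n : ℤ) ≤ k) (h2 : k ≤ n) (i : Fin 2) :
    ((edgeInclusion n k h1 h2).toFun i).1 =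
      if Even k then k + (i.val : ℤ) else k + (1 - (i.val : ℤ)) := rfl

theorem parity_edgeInclusion (n : ℕ) (k : ℤ) (h1 : -(n : ℤ) ≤ k) (h2 : k ≤ n) (i : Fin 2) :
    parity ((edgeInclusion n k h1 h2).toFun i).1 = i :=
  (edgeInclusion n k h1 h2).color_eq i

/-- Vertices of a path on the edge `{k, k + 1}` are determined by their color. -/
theorem edgeInclusion_parity (n : ℕ) (k : ℤ) (h1 : -(n : ℤ) ≤ k) (h2 : k ≤ n)
    (y : (symLine n).graph.V) (hy : y.1 = k ∨ y.1 = k + 1) :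
    (edgeInclusion n k h1 h2).toFun (parity y.1) = y := by
  refine Subtype.ext ?_
  have h := (parity_eq_iff _ _).1 (parity_edgeInclusion n k h1 h2 (parity y.1))
  have hi := (parity y.1).isLt
  rw [edgeInclusion_val] at h ⊢
  split_ifs at h ⊢ <;> omega

variable {X : Bigraph.{u}}

/-- The values of a stable path, as a map from the integers. -/
def value (f : X.stablePath.V) : ℤ → X.graph.V :=
  Quot.lift (fun p k => p.2.1 (fold p.1 k)) (by
    rintro ⟨n, g⟩ _ rfl
    funext k
    exact congrArg g.1 (retraction_fold n k).symm) f

theorem color_value (f : X.stablePath.V) (k : ℤ) : X.color.toFun (value f k) = parity k := by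
  induction f using Quot.ind with
  | mk p => exact (p.2.2 _).trans (parity_fold _ _)

/-- The stable path represented by the restriction of a map to `L_{-n,n+1}`. -/
def ofValue (n : ℕ) (φ : ℤ → X.graph.V) (hφ : ∀ k, X.color.toFun (φ k) = parity k) :
    X.stablePath.V :=
  Quot.mk _ ⟨n, fun y => φ y.1, fun y => hφ y.1⟩

/-- Beyond the stage of a representative, restricting the values to a longer interval is pulling
back along one more retraction, which the colimit identifies. -/
theorem exists_forall_ofValue_eq (f : X.stablePath.V) :
    ∃ n, ∀ N, n ≤ N → ofValue N (value f) (color_value f) = f := by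
  induction f using Quot.ind with
  | mk p =>
    obtain ⟨n, g⟩ := p
    refine ⟨n, fun N hN => ?_⟩
    induction N, hN using Nat.le_induction with
    | base =>
      refine congrArg (Quot.mk _) (Sigma.ext rfl
        (heq_of_eq (Subtype.ext (funext fun y => ?_))))
      exact congrArg g.1 (fold_coe n y)
    | succ N hN ih =>
      refine Eq.trans ?_ ih
      refine Eq.symm (Quot.sound (Sigma.ext rfl (heq_of_eq (Subtype.ext (funext fun y => ?_)))))
      exact (congrArg g.1 (fold_retraction hN y)).symm

/-- A stage of the colimit from which on a stable path is represented by its restrictions. -/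
noncomputable def stage (f : X.stablePath.V) : ℕ := (exists_forall_ofValue_eq f).choose

theorem ofValue_eq (f : X.stablePath.V) {N : ℕ} (h : stage f ≤ N) :
    ofValue N (value f) (color_value f) = f :=
  (exists_forall_ofValue_eq f).choose_spec N h

theorem value_ofValue (n : ℕ) (φ : ℤ → X.graph.V) (hφ : ∀ k, X.color.toFun (φ k) = parity k)
    (k : ℤ) : value (ofValue n φ hφ) k = φ (fold n k).1 := rfl

theorem evalPosInf_ofValue (n : ℕ) (φ : ℤ → X.graph.V)
    (hφ : ∀ k, X.color.toFun (φ k) = parity k) (i : Fin 2) :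
    (X.evalPosInf.toFun (ofValue n φ hφ)).1 i =
      φ ((edgeInclusion n (n : ℤ) (by omega) le_rfl).toFun i).1 := rfl

theorem evalNegInf_ofValue (n : ℕ) (φ : ℤ → X.graph.V)
    (hφ : ∀ k, X.color.toFun (φ k) = parity k) (i : Fin 2) :
    (X.evalNegInf.toFun (ofValue n φ hφ)).1 i =
      φ ((edgeInclusion n (-(n : ℤ)) le_rfl (by omega)).toFun i).1 := rfl

/-- From `N` on, folding only alternates between the ends of the last edge `{N, N + 1}`, and parity
tells which one. -/
theorem value_eq_evalPosInf (f : X.stablePath.V) {N : ℕ} (h : stage f ≤ N) {k : ℤ}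
    (hk : N ≤ k) : value f k = (X.evalPosInf.toFun f).1 (parity k) := by
  have h1 := ofValue_eq f h
  rw [← parity_fold N k]
  conv_lhs => rw [← h1, value_ofValue]
  conv_rhs => rw [← h1, evalPosInf_ofValue]
  rw [edgeInclusion_parity]
  rw [fold_val]
  split_ifs <;> omega

theorem value_eq_evalNegInf (f : X.stablePath.V) {N : ℕ} (h : stage f ≤ N) {k : ℤ}
    (hk : k ≤ -N) : value f k = (X.evalNegInf.toFun f).1 (parity k) := by
  have h1 := ofValue_eq f h
  rw [← parity_fold N k]
  conv_lhs => rw [← h1, value_ofValue]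
  conv_rhs => rw [← h1, evalNegInf_ofValue]
  rw [edgeInclusion_parity]
  rw [fold_val]
  split_ifs <;> omega

/-- Adjacency in the colimit becomes a condition on values alone: two paths whose values are
adjacent have adjacent representatives at any stage beyond both of theirs. -/
theorem stablePath_adj_iff (f g : X.stablePath.V) :
    X.stablePath.Adj f g ↔ ∀ k l : ℤ, |k - l| = 1 → X.graph.Adj (value f k) (value g l) := by
  constructor
  · rintro ⟨n, x, y, rfl, rfl, h⟩ k l hkl
    exact h _ _ (fold_adj n hkl)
  · intro h
    refine ⟨max (stage f) (stage g), _, _, (ofValue_eq f (le_max_left _ _)).symm,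
      (ofValue_eq g (le_max_right _ _)).symm, fun y y' hy => h _ _ hy⟩

/-- The map that agrees with the stable path `f` on `{-m, …, m + 1}` and with the edges `a` and
`b` to the left and to the right. -/
def extendValue (m : ℕ) (a b : (X.exp K2).V) (f : X.stablePath.V) (k : ℤ) : X.graph.V :=
  if k < -(m : ℤ) then a.1 (parity k) else if (m : ℤ) + 1 < k then b.1 (parity k) else value f k

theorem color_extendValue (m : ℕ) (a b : (X.exp K2).V) (f : X.stablePath.V) (k : ℤ) :
    X.color.toFun (extendValue m a b f k) = parity k := by
  unfold extendValue
  split_ifs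
  exacts [a.2 _, b.2 _, color_value f k]

/-- The stable path that agrees with `f` on `{-m, …, m + 1}` and with the edges `a` and `b` to
the left and to the right. -/
def extend (m : ℕ) (a b : (X.exp K2).V) (f : X.stablePath.V) : X.stablePath.V :=
  -- With `m + 2`, the outermost edges `{-m - 2, -m - 1}` and `{m + 2, m + 3}` lie wholly in the
  -- regions governed by `a` and `b`; `m + 1` would not suffice.
  ofValue (m + 2) (extendValue m a b f) (color_extendValue m a b f)

/-! ### Ends and adjacency of paths that have been cut off. -/

section Extend

variable {m : ℕ} {a b : (X.exp K2).V}

theorem value_extend (f : X.stablePath.V) (k : ℤ) :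
    value (extend m a b f) k = extendValue m a b f k := by
  rw [extend, value_ofValue]
  unfold extendValue
  rw [parity_fold]
  have h := fold_val (m + 2) k
  push_cast at h
  by_cases h1 : k < -(m : ℤ)
  · rw [if_pos h1, if_pos]
    rw [h]
    split_ifs <;> omega
  by_cases h2 : (m : ℤ) + 1 < k
  · rw [if_neg h1, if_pos h2, if_neg, if_pos]
    all_goals
      rw [h]
      split_ifs <;> omega
  · have h3 : (fold (m + 2) k).1 = k := by
      rw [h]
      split_ifs <;> omega
    rw [h3]

theorem evalPosInf_extend (f : X.stablePath.V) : X.evalPosInf.toFun (extend m a b f) = b := by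
  refine Subtype.ext (funext fun (i : Fin 2) => ?_)
  rw [extend, evalPosInf_ofValue]
  have h := edgeInclusion_val (m + 2) ((m + 2 : ℕ) : ℤ) (by omega) le_rfl i
  have hi := i.isLt
  unfold extendValue
  rw [if_neg, if_pos, parity_edgeInclusion]
  all_goals
    rw [h]
    push_cast
    split_ifs <;> omega

theorem evalNegInf_extend (f : X.stablePath.V) : X.evalNegInf.toFun (extend m a b f) = a := by
  refine Subtype.ext (funext fun (i : Fin 2) => ?_)
  rw [extend, evalNegInf_ofValue]
  have h := edgeInclusion_val (m + 2) (-((m + 2 : ℕ) : ℤ)) le_rfl (by omega) i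
  have hi := i.isLt
  unfold extendValue
  rw [if_pos, parity_edgeInclusion]
  rw [h]
  push_cast
  split_ifs <;> omega

theorem exp_K2_adj {c d : (X.exp K2).V} (h : (X.exp K2).Adj c d) {k l : ℤ} (hkl : |k - l| = 1) :
    X.graph.Adj (c.1 (parity k)) (d.1 (parity l)) :=
  h _ _ (parity_ne_of_adj hkl)

/-- Only `f` must have stabilized by `m`: where `g` has been replaced by `a` or `b`, the neighboring
value of `f` already belongs to its end edge. -/
theorem adj_extend {f g : X.stablePath.V} (h : X.stablePath.Adj f g) (hf : stage f ≤ m)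
    (ha : (X.exp K2).Adj (X.evalNegInf.toFun f) a)
    (hb : (X.exp K2).Adj (X.evalPosInf.toFun f) b) :
    X.stablePath.Adj f (extend m a b g) := by
  rw [stablePath_adj_iff] at h ⊢
  intro k l hkl
  have hkl' := (abs_eq (by norm_num)).1 hkl
  rw [value_extend, extendValue]
  split_ifs with h1 h2
  · rw [value_eq_evalNegInf f hf (by omega)]
    exact exp_K2_adj ha hkl
  · rw [value_eq_evalPosInf f hf (by omega)]
    exact exp_K2_adj hb hkl
  · exact h k l hkl

/-- The stage conditions are crossed. Where one path is replaced and the other is not, it is the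
unreplaced path that must have stabilized by the cutoff of the replaced one. -/
theorem extend_adj_extend {m' : ℕ} {f g : X.stablePath.V} (h : X.stablePath.Adj f g)
    (hf : stage f ≤ m') (hg : stage g ≤ m) (haa : (X.exp K2).Adj a a) (hbb : (X.exp K2).Adj b b)
    (haf : (X.exp K2).Adj (X.evalNegInf.toFun f) a)
    (hbf : (X.exp K2).Adj (X.evalPosInf.toFun f) b)
    (hag : (X.exp K2).Adj a (X.evalNegInf.toFun g))
    (hbg : (X.exp K2).Adj b (X.evalPosInf.toFun g)) :
    X.stablePath.Adj (extend m a b f) (extend m' a b g) := by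
  rw [stablePath_adj_iff] at h ⊢
  intro k l hkl
  have hkl' := (abs_eq (by norm_num)).1 hkl
  rw [value_extend, value_extend, extendValue, extendValue]
  split_ifs
  · exact exp_K2_adj haa hkl
  · omega
  · rw [value_eq_evalNegInf g hg (by omega)]
    exact exp_K2_adj hag hkl
  · omega
  · exact exp_K2_adj hbb hkl
  · rw [value_eq_evalPosInf g hg (by omega)]
    exact exp_K2_adj hbg hkl
  · rw [value_eq_evalNegInf f hf (by omega)]
    exact exp_K2_adj haf hkl
  · rw [value_eq_evalPosInf f hf (by omega)]
    exact exp_K2_adj hbf hkl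
  · exact h k l hkl

end Extend

/-- Exhibits a lower fiber as given by a condition on single vertices, that is, as a full
subcomplex. -/
theorem mem_of_cliqueMap_le {G H : LoopGraph.{u}} {φ : LoopGraph.Hom G H}
    {ρ : LoopGraph.CliquePoset H} {τ : LoopGraph.CliquePoset G} :
    LoopGraph.cliqueMap φ τ ≤ ρ ↔ ∀ f ∈ τ.1, φ.toFun f ∈ ρ.1 := by
  classical
  exact Finset.image_subset_iff

end Bigraph

/-! ### Applying the criterion to lower fibers. -/

open Bigraph

theorem proposition4p2 (X : Bigraph.{u}) :
    QuillenBHypothesis (LoopGraph.cliqueMap X.endpoints) := by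
  classical
  intro ρ ρ' hρ
  obtain ⟨⟨a, b⟩, hv⟩ := ρ.2.1
  have hv' := hρ hv
  have hadj : ∀ f : X.stablePath.V, X.endpoints.toFun f ∈ ρ'.1 →
      ((X.exp K2).Adj (X.evalNegInf.toFun f) a ∧ (X.exp K2).Adj (X.evalPosInf.toFun f) b) ∧
      ((X.exp K2).Adj a (X.evalNegInf.toFun f) ∧ (X.exp K2).Adj b (X.evalPosInf.toFun f)) :=
    fun f hf => ⟨ρ'.2.2 _ hf _ hv', ρ'.2.2 _ hv' _ hf⟩
  have hab := ρ'.2.2 _ hv' _ hv'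
  have hext : ∀ m f, X.endpoints.toFun (extend m a b f) ∈ ρ.1 := fun m f => by
    have : X.endpoints.toFun (extend m a b f) = (a, b) :=
      Prod.ext (evalNegInf_extend f) (evalPosInf_extend f)
    rwa [this]
  let e : LowerFiber (LoopGraph.cliqueMap X.endpoints) ρ' ↪o Finset X.stablePath.V :=
    ⟨⟨fun τ => τ.1.1, fun τ τ' h => Subtype.ext (Subtype.ext h)⟩, Iff.rfl⟩
  have hend : ∀ τ, ∀ f ∈ e τ, X.endpoints.toFun f ∈ ρ'.1 := fun τ => mem_of_cliqueMap_le.1 τ.2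
  have hstage : ∀ τ, ∀ f ∈ e τ, stage f ≤ (e τ).sup stage := fun τ f hf => Finset.le_sup hf
  refine isPosetHomotopyEquiv_of_push (e := e)
    -- The cutoff is the largest stage in the face `τ`, so it is late enough for every path in any
    -- face contained in `τ`.
    (E := fun τ f => extend ((e τ).sup stage) a b f)
    (lowerFiberInclusion _ hρ) (fun _ _ h => h) (A := {f | X.endpoints.toFun f ∈ ρ.1})
    (fun τ => ?_) (fun τ => τ.1.2.1) (fun τ s hs hne => ?_) (fun τ J hJ => ?_)
    fun τ f _ => hext _ f
  · constructor
    · rintro ⟨τ, rfl⟩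
      exact mem_of_cliqueMap_le.1 τ.2
    · intro h
      exact ⟨⟨τ.1, mem_of_cliqueMap_le.2 h⟩, rfl⟩
  · exact ⟨⟨⟨s, hne, fun x hx y hy => τ.1.2.2 x (hs hx) y (hs hy)⟩,
      mem_of_cliqueMap_le.2 fun f hf => hend τ f (hs hf)⟩, rfl⟩
  · have hle : ∀ j ∈ J, ∀ f ∈ e τ, stage f ≤ (e j).sup stage := fun j hj f hf =>
      hstage j f (hJ j hj hf)
    have hmem : ∀ g, g ∈ e τ ∪ J.biUnion (fun j => (e τ).image
        (extend ((e j).sup stage) a b)) ↔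
        g ∈ e τ ∨ ∃ j ∈ J, ∃ f ∈ e τ, extend ((e j).sup stage) a b f = g := by simp
    -- The common face is the clique `τ` together with its images under all the cutoffs attached to
    -- `J`.
    refine ⟨⟨⟨e τ ∪ J.biUnion fun j => (e τ).image (extend ((e j).sup stage) a b),
      τ.1.2.1.mono Finset.subset_union_left, fun x hx y hy => ?_⟩,
      mem_of_cliqueMap_le.2 fun g hg => ?_⟩, Finset.subset_union_left, fun j hj f hf =>
      (hmem _).2 (Or.inr ⟨j, hj, f, hf, rfl⟩)⟩
    · rw [hmem] at hx hy
      rcases hx with hx | ⟨j, hj, f, hf, rfl⟩ <;> rcases hy with hy | ⟨j', hj', g, hg, rfl⟩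
      · exact τ.1.2.2 x hx y hy
      · obtain ⟨⟨h1, h2⟩, -⟩ := hadj x (hend τ x hx)
        exact adj_extend (τ.1.2.2 x hx g hg) (hle j' hj' x hx) h1 h2
      · obtain ⟨⟨h1, h2⟩, -⟩ := hadj y (hend τ y hy)
        exact X.stablePath.symm _ _ (adj_extend (τ.1.2.2 y hy f hf) (hle j hj y hy) h1 h2)
      · obtain ⟨⟨h1, h2⟩, -⟩ := hadj f (hend τ f hf)
        obtain ⟨-, h3, h4⟩ := hadj g (hend τ g hg)
        exact extend_adj_extend (τ.1.2.2 f hf g hg) (hle j' hj' f hf) (hle j hj g hg)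
          hab.1 hab.2 h1 h2 h3 h4
    · rcases (hmem g).1 hg with hg | ⟨j, -, f, -, rfl⟩
      exacts [hend τ g hg, hρ (hext _ f)]
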